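/- Let $X=L^2(\mathbb R)$ (complex-valued functions, Lebesgue measure) and let $H=-i\frac{d}{dx}$ with domain $D(H)=H^1(\mathbb R)=\{f\in L^2(\mathbb R): f'\in L^2(\mathbb R)\}$, the derivative being taken in the sense of distributions. Then $H$ is self-adjoint, and the strongly continuous one-parameter unitary group $e^{-itH}$ generated by $H$ is translation: $(e^{-itH}\psi)(x)=\psi(x-t)$ for all $\psi\in X$, $t\in\mathbb R$. Let $\psi_0(x)=\max(0,1-|x-1|)$ be the tent function and $\psi(t)=e^{-itH}\psi_0$. There is a densely defined linear operator $A:D(A)\to X$, $D(A)\subseteq X$, that is hermitean (that is, $\langle A\psi,\varphi\rangle=\langle\psi,A\varphi\rangle$ for all $\psi,\varphi\in D(A)$), but neither self-adjoint nor closed, such that $e^{-itH}$ maps $D(A)\cap D(H)$ into itself for every $t\in\mathbb R$, $\psi_0\in D(A)\cap D(H)$ (so that $\psi(t)\in D(A)\cap D(H)$ for all $t$), and the real-valued function $t\mapsto\langle A\rangle_{\psi(t)}:=\langle\psi(t),A\psi(t)\rangle$ is not bounded above on $(0,1)$. In particular, self-adjointness of $A$ in Ehrenfest's theorem, and closedness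 of $A$ in the accompanying local bound, cannot be weakened to hermiticity. Namely, for these $H$, $A$, $\psi_0$: - $t\mapsto\langle A\rangle_{\psi(t)}$ is not continuous; hence it is false that $\langle A\rangle_{\psi(t)}$ is continuously differentiable with $$\frac{d}{dt}\langle A\rangle_{\psi(t)}=i\bigl(\langle H\psi(t),A\psi(t)\rangle-\langle A\psi(t),H\psi(t)\rangle\bigr)\quad\text{for all } t\in\mathbb R,$$ which is the conclusion of Ehrenfest's theorem for self-adjoint $A$; - it is false that $\sup_{t\in I}\|A e^{-itH}\psi_0\|<\infty$ for every bounded $I\subset\mathbb R$, which is the conclusion valid for closed, densely defined hermitean $A$. -/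

import Mathlib

open MeasureTheory Filter Topology TemperedDistribution
open scoped SchwartzMap

noncomputable section

namespace Ehrenfest

/-! ### Unitary groups and hermitean operators on a complex Hilbert space -/

section Abstract

variable {X : Type*} [NormedAddCommGroup X] [InnerProductSpace ℂ X] [CompleteSpace X]

/-- `U t = exp (-i t H)`: `U` is a strongly continuous one-parameter unitary group, and `H` is
exactly its generator, i.e. `ψ ∈ D(H)` with `H ψ = φ` if and only if `i (U t ψ - ψ) / t → φ`
as `t → 0`, `t ≠ 0`. -/
structure IsUnitaryGroupOf (H : X →ₗ.[ℂ] X) (U : ℝ → X →L[ℂ] X) : Prop where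
  unitary : ∀ t, U t ∈ unitary (X →L[ℂ] X)
  zero : U 0 = 1
  add : ∀ s t, U (s + t) = U s * U t
  continuous : ∀ ψ, Continuous fun t => U t ψ
  generator : ∀ ψ φ, (ψ, φ) ∈ H.graph ↔
    Tendsto (fun t : ℝ => (Complex.I / (t : ℂ)) • (U t ψ - ψ)) (𝓝[≠] 0) (𝓝 φ)

/-- `A` is hermitean: `⟨A ψ, φ⟩ = ⟨ψ, A φ⟩` for all `ψ, φ ∈ D(A)`. -/
def IsHermitean (A : X →ₗ.[ℂ] X) : Prop :=
  ∀ ψ φ : A.domain, inner ℂ (A ψ) (φ : X) = inner ℂ (ψ : X) (A φ)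

/-- The hypotheses of the Ehrenfest theorem, with `A` only densely defined and hermitean
instead of self-adjoint (or hermitean and closed). -/
structure WeakHypotheses (H A : X →ₗ.[ℂ] X) (U : ℝ → X →L[ℂ] X) : Prop where
  selfAdjoint : IsSelfAdjoint H
  dense_H : Dense (H.domain : Set X)
  group : IsUnitaryGroupOf H U
  dense_A : Dense (A.domain : Set X)
  hermitean : IsHermitean A
  invariant : ∀ t, ∀ ψ ∈ A.domain ⊓ H.domain, U t ψ ∈ A.domain ⊓ H.domain

/-- The expected value `⟨ψ, A ψ⟩` for `ψ ∈ D(A)`. -/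
def expVal (A : X →ₗ.[ℂ] X) (ψ : A.domain) : ℂ :=
  inner ℂ (ψ : X) (A ψ)

/-- The conclusion of the Ehrenfest theorem for the initial state `ψ₀`, with
`ψ(t) = U t ψ₀ ∈ D(A) ∩ D(H)`: `t ↦ ⟨A⟩_{ψ(t)}` is continuously differentiable, with derivative
`i (⟨H ψ(t), A ψ(t)⟩ - ⟨A ψ(t), H ψ(t)⟩)`. -/
def EhrenfestConclusion (H A : X →ₗ.[ℂ] X) (U : ℝ → X →L[ℂ] X) (ψ₀ : X)
    (h : ∀ t, U t ψ₀ ∈ A.domain ⊓ H.domain) : Prop :=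
  ContDiff ℝ 1 (fun t => expVal A ⟨U t ψ₀, (h t).1⟩) ∧
  ∀ t, HasDerivAt (fun t => expVal A ⟨U t ψ₀, (h t).1⟩)
    (Complex.I * (inner ℂ (H ⟨U t ψ₀, (h t).2⟩) (A ⟨U t ψ₀, (h t).1⟩) -
      inner ℂ (A ⟨U t ψ₀, (h t).1⟩) (H ⟨U t ψ₀, (h t).2⟩))) t

/-- `sup_{t ∈ I} ‖A U(t) ψ₀‖ < ∞` for every bounded set `I` of times. -/
def LocallyBoundedAlongOrbit (A : X →ₗ.[ℂ] X) (U : ℝ → X →L[ℂ] X) (ψ₀ : X)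
    (h : ∀ t, U t ψ₀ ∈ A.domain) : Prop :=
  ∀ I : Set ℝ, Bornology.IsBounded I → BddAbove ((fun t => ‖A ⟨U t ψ₀, h t⟩‖) '' I)

end Abstract

/-! ### The momentum operator and translations on `L²(ℝ)` -/

/-- `L²(ℝ)`, complex valued, with Lebesgue measure. -/
abbrev L2R : Type := Lp ℂ 2 (volume : Measure ℝ)

/-- The pairs `(f, g)` in `L² × L²` with `f' = i g`, i.e. `g = -i f'`, in the sense of
distributions. -/
def momentumGraph : Submodule ℂ (L2R × L2R) where
  carrier := {p | derivCLM ℂ (Lp.toTemperedDistributionCLM ℂ volume 2 p.1) =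
    Lp.toTemperedDistributionCLM ℂ volume 2 (Complex.I • p.2)}
  zero_mem' := by
    rw [Set.mem_ofPred_eq, Prod.fst_zero, Prod.snd_zero, smul_zero, map_zero, map_zero]
  add_mem' {p q} hp hq := by
    rw [Set.mem_ofPred_eq] at *
    rw [Prod.fst_add, Prod.snd_add, smul_add, map_add, map_add, map_add, hp, hq]
  smul_mem' c p hp := by
    rw [Set.mem_ofPred_eq] at *
    rw [Prod.smul_fst, Prod.smul_snd, smul_comm, map_smul, map_smul, map_smul, hp]

theorem momentumGraph_functional (p : L2R × L2R) (hp : p ∈ momentumGraph) (h0 : p.1 = 0) :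
    p.2 = 0 := by
  have h : derivCLM ℂ (Lp.toTemperedDistributionCLM ℂ volume 2 p.1) =
    Lp.toTemperedDistributionCLM ℂ volume 2 (Complex.I • p.2) := hp
  rw [h0, map_zero, map_zero] at h
  have hk := Lp.ker_toTemperedDistributionCLM_eq_bot (F := ℂ) (μ := (volume : Measure ℝ)) (p := 2)
  have hm : Complex.I • p.2 ∈ (⊥ : Submodule ℂ L2R) := by
    rw [← hk]
    exact h.symm
  rw [Submodule.mem_bot] at hm
  exact (smul_eq_zero.mp hm).resolve_left Complex.I_ne_zero

/-- `H = -i d/dx` on its domain `H¹(ℝ) = {f ∈ L² | f' ∈ L²}`, the derivative being taken in the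
sense of distributions. -/
def momentum : L2R →ₗ.[ℂ] L2R := momentumGraph.toLinearPMap

/-- The graph of `momentum` is `momentumGraph`. -/
theorem momentum_graph : momentum.graph = momentumGraph :=
  Submodule.toLinearPMap_graph_eq _ momentumGraph_functional

/-- Translation, `(translation t ψ)(x) = ψ(x - t)`. -/
def translation (t : ℝ) : L2R →L[ℂ] L2R :=
  (Lp.compMeasurePreservingₗᵢ ℂ (fun x : ℝ => x - t)
    (measurePreserving_sub_right volume t)).toContinuousLinearMap

/-- The tent function: `0` at `0` and `2`, `1` at `1`, and linear on each of
`(-∞, 0)`, `(0, 1)`, `(1, 2)`, `(2, ∞)`; it vanishes outside `[0, 2]`. -/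
def tentFun (x : ℝ) : ℝ := max 0 (1 - |x - 1|)

theorem memLp_tentFun : MemLp (fun x => (tentFun x : ℂ)) 2 (volume : Measure ℝ) := by
  have hc : Continuous fun x => (tentFun x : ℂ) := by
    unfold tentFun
    fun_prop
  refine hc.memLp_of_hasCompactSupport (HasCompactSupport.intro (K := Set.Icc 0 2)
    isCompact_Icc fun x hx => ?_)
  have h : 1 - |x - 1| ≤ 0 := by
    by_contra! h
    have h' : |x - 1| < 1 := by linarith
    rw [abs_lt] at h'
    exact hx ⟨by linarith, by linarith⟩
  simp [tentFun, h]

/-- The tent function as an element of `L²(ℝ)`. -/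
def tent : L2R := memLp_tentFun.toLp _

end Ehrenfest

end

/-! The operator is a diagonal sum `A f = ∑ cₙ ⟨vₙ, f⟩ vₙ`, where `vₙ` is a step function on `(4hₙ,
8hₙ]`, `hₙ = 2^{-(n+3)}`, orthogonal to affine functions. Its domain consists of those `f` for
which, at every shift `t`, only finitely many translates of the `vₙ` by `t` pair nontrivially with
`f`. Quantifying over all `t` makes the domain invariant under translation, and real `cₙ` make `A`
hermitean.

Piecewise affine functions with finitely many break points belong to the domain: the supports are
essentially disjoint, so a break point meets at most one of them
(`mem_finiteDomain_of_piecewise_affine`). This gives density and covers the tent. At time `5hₙ` the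
corner of the tent at `0` lies inside the support of `vₙ`, and `cₙ` is chosen so large that this
single term equals `n` (`inner_haar_translation_tent`). All terms are nonnegative, so the
expectation is unbounded near `t = 0`.

`A` is not closed: it vanishes on step functions supported in `(10, 11)`, and these approximate `x²`
cut off to that interval, which is not in the domain. Hence `A` is not self-adjoint either.

The facts about `H` rest on one duality criterion, `hasDerivAt_iff_forall_inner`: a dense invariant
set of differentiable orbits determines the generator. On Schwartz functions it identifies the
generator of translations with the distributional `-i d/dx`; on the graph of the generator itself it
gives self-adjointness. -/

noncomputable section

namespace Ehrenfest

/-! ### Generators of unitary groups: duality, self-adjointness, uniqueness. -/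

section Abstract

variable {X : Type*} [NormedAddCommGroup X] [InnerProductSpace ℂ X] [CompleteSpace X]

/-- A strongly continuous one-parameter unitary group. -/
structure IsUnitaryGroup (U : ℝ → X →L[ℂ] X) : Prop where
  unitary : ∀ t, U t ∈ unitary (X →L[ℂ] X)
  zero : U 0 = 1
  add : ∀ s t, U (s + t) = U s * U t
  continuous : ∀ ψ, Continuous fun t => U t ψ

theorem IsUnitaryGroupOf.isUnitaryGroup {H : X →ₗ.[ℂ] X} {U : ℝ → X →L[ℂ] X}
    (hU : IsUnitaryGroupOf H U) : IsUnitaryGroup U :=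
  ⟨hU.unitary, hU.zero, hU.add, hU.continuous⟩

omit [CompleteSpace X] in
/-- The limit defining the generator is the derivative of the orbit at time zero. -/
theorem tendsto_generator_iff {U : ℝ → X →L[ℂ] X} (h0 : U 0 = 1) (ψ φ : X) :
    Tendsto (fun t : ℝ => (Complex.I / (t : ℂ)) • (U t ψ - ψ)) (𝓝[≠] 0) (𝓝 φ) ↔
      HasDerivAt (fun t => U t ψ) (-Complex.I • φ) 0 := by
  rw [hasDerivAt_iff_tendsto_slope_zero]
  have e : ∀ t : ℝ, (Complex.I / (t : ℂ)) • (U t ψ - ψ)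
      = Complex.I • (t⁻¹ • (U (0 + t) ψ - U 0 ψ)) := by
    intro t
    rw [zero_add, h0, one_apply_eq_self, ← Complex.coe_smul t⁻¹, smul_smul,
      Complex.ofReal_inv, div_eq_mul_inv]
  simp_rw [e]
  constructor
  · intro h
    simpa [smul_smul] using h.const_smul (-Complex.I)
  · intro h
    simpa [smul_smul] using h.const_smul Complex.I

namespace IsUnitaryGroup

variable {U : ℝ → X →L[ℂ] X} (hU : IsUnitaryGroup U)
include hU

theorem apply_add (s t : ℝ) (x : X) : U (s + t) x = U s (U t x) := by
  rw [hU.add, mul_apply_eq_comp]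

theorem apply_zero (x : X) : U 0 x = x := by
  rw [hU.zero, one_apply_eq_self]

theorem inner_map_map (t : ℝ) (x y : X) : inner ℂ (U t x) (U t y) = inner ℂ x y := by
  have h : star (U t) * U t = 1 := Unitary.star_mul_self_of_mem (hU.unitary t)
  rw [← ContinuousLinearMap.adjoint_inner_right, ← ContinuousLinearMap.star_eq_adjoint,
    ← mul_apply_eq_comp, h, one_apply_eq_self]

theorem inner_map_left (t : ℝ) (x y : X) : inner ℂ (U t x) y = inner ℂ x (U (-t) y) := by
  rw [← hU.inner_map_map t x, ← hU.apply_add, add_neg_cancel, hU.apply_zero]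

theorem hasDerivAt_apply {ψ φ : X} (h : HasDerivAt (fun t => U t ψ) (-Complex.I • φ) 0) (t : ℝ) :
    HasDerivAt (fun t => U t ψ) (-Complex.I • U t φ) t := by
  have h1 : HasDerivAt (fun s => U s ψ) (-Complex.I • φ) (t - t) := by rwa [sub_self]
  have h2 := ((U t).restrictScalars ℝ).hasFDerivAt.comp_hasDerivAt t (h1.comp_sub_const t t)
  have e : (((U t).restrictScalars ℝ) ∘ fun x => U (x - t) ψ) = fun t => U t ψ := by
    ext s
    simp [← hU.apply_add]
  rw [e] at h2
  simpa using h2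

/-- A dense set of vectors with known derivatives that is stable under the group determines the
generator by duality. -/
theorem hasDerivAt_iff_forall_inner (C : Set (X × X)) (hC : Dense (Prod.fst '' C))
    (hinv : ∀ t, ∀ p ∈ C, (U t p.1, U t p.2) ∈ C)
    (hgen : ∀ p ∈ C, HasDerivAt (fun t => U t p.1) (-Complex.I • p.2) 0) (f η : X) :
    HasDerivAt (fun t => U t f) (-Complex.I • η) 0 ↔
      ∀ p ∈ C, inner ℂ p.1 η = inner ℂ p.2 f := by
  constructor
  · intro h p hp
    -- By unitarity `⟨U t p.1, U t f⟩` is constant in `t`, so its product-rule derivative vanishes.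
    have h1 := (hgen p hp).inner ℂ h
    simp only [hU.inner_map_map, hU.apply_zero] at h1
    have h2 := h1.unique (hasDerivAt_const (0 : ℝ) (inner ℂ p.1 f))
    simp only [inner_smul_left, inner_smul_right, map_neg, Complex.conj_I, neg_neg] at h2
    have h3 : Complex.I * (inner ℂ p.2 f - inner ℂ p.1 η) = 0 := by
      linear_combination h2
    rw [mul_eq_zero, or_iff_right Complex.I_ne_zero, sub_eq_zero] at h3
    exact h3.symm
  · intro h
    -- The expected integrated equation is `U (-t) f = f + F t`. Tested against `p.1` it says that
    -- `⟨U s p.1, f⟩ - ⟨p.1, F s⟩` is constant in `s`, which is the hypothesis at the shifted pair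
    -- `(U s p.1, U s p.2)`. Density removes the test vector.
    set F : ℝ → X := fun t => ∫ s in (0 : ℝ)..t, Complex.I • U (-s) η with hF
    have hcont : Continuous fun s : ℝ => Complex.I • U (-s) η :=
      ((hU.continuous η).comp continuous_neg).const_smul _
    have hFd : ∀ t, HasDerivAt F (Complex.I • U (-t) η) t := fun t =>
      intervalIntegral.integral_hasDerivAt_right (hcont.intervalIntegrable _ _)
        (hcont.stronglyMeasurableAtFilter _ _) hcont.continuousAt
    have key : ∀ t, U (-t) f = f + F t := by
      intro t
      have hz : ∀ p ∈ C, inner ℂ p.1 (U (-t) f - F t) = inner ℂ p.1 f := by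
        intro p hp
        have hd : ∀ s, HasDerivAt (fun s => inner ℂ (U s p.1) f - inner ℂ p.1 (F s)) 0 s := by
          intro s
          have d1 := (hU.hasDerivAt_apply (hgen p hp) s).inner ℂ (hasDerivAt_const s f)
          have d2 := (hasDerivAt_const s p.1).inner ℂ (hFd s)
          refine (d1.sub d2).congr_deriv ?_
          have := h _ (hinv s p hp)
          rw [hU.inner_map_left] at this
          simp [inner_smul_left, inner_smul_right, this]
        have := is_const_of_deriv_eq_zero (fun s => (hd s).differentiableAt)
          (fun s => (hd s).deriv) t 0
        simpa [hF, hU.apply_zero, inner_sub_right, hU.inner_map_left] using this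
      have : U (-t) f - F t = f := by
        refine hC.eq_of_inner_right (𝕜 := ℂ) ?_
        rintro v ⟨p, hp, rfl⟩
        exact hz p hp
      exact (sub_eq_iff_eq_add.1 this)
    have e : (fun t => U t f) = fun t => f + F (-t) := by
      ext t
      rw [← key, neg_neg]
    rw [e]
    have h1 : HasDerivAt F (Complex.I • U (-(-0)) η) (-0) := hFd (-0)
    have h2 := (h1.scomp (0 : ℝ) (hasDerivAt_neg (0 : ℝ))).const_add f
    simpa [hU.apply_zero, Function.comp_def] using h2

end IsUnitaryGroup

namespace IsUnitaryGroupOf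

variable {H : X →ₗ.[ℂ] X} {U : ℝ → X →L[ℂ] X}

theorem mem_graph_iff (hU : IsUnitaryGroupOf H U) (ψ φ : X) :
    (ψ, φ) ∈ H.graph ↔ HasDerivAt (fun t => U t ψ) (-Complex.I • φ) 0 :=
  (hU.generator ψ φ).trans (tendsto_generator_iff hU.zero ψ φ)

theorem map_mem_graph (hU : IsUnitaryGroupOf H U) (t : ℝ) {p : X × X} (hp : p ∈ H.graph) :
    (U t p.1, U t p.2) ∈ H.graph := by
  rw [hU.mem_graph_iff] at hp ⊢
  have h := ((U t).restrictScalars ℝ).hasFDerivAt.comp_hasDerivAt 0 hp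
  have e : (((U t).restrictScalars ℝ) ∘ fun x => U x p.1) = fun s => U s (U t p.1) := by
    ext s
    simp [← hU.isUnitaryGroup.apply_add, add_comm]
  rw [e] at h
  simpa using h

omit [CompleteSpace X] in
theorem image_fst_graph (H : X →ₗ.[ℂ] X) : Prod.fst '' (H.graph : Set (X × X)) = H.domain := by
  ext x
  constructor
  · rintro ⟨p, hp, rfl⟩
    exact LinearPMap.mem_domain_of_mem_graph hp
  · intro hx
    exact ⟨_, H.mem_graph ⟨x, hx⟩, rfl⟩

/-- A densely defined generator of a unitary group is self-adjoint. -/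
theorem isSelfAdjoint (hU : IsUnitaryGroupOf H U) (hd : Dense (H.domain : Set X)) :
    IsSelfAdjoint H := by
  -- With the graph of `H` itself as test set, the duality condition is membership in the graph of
  -- the adjoint.
  have key := hU.isUnitaryGroup.hasDerivAt_iff_forall_inner (H.graph : Set (X × X))
    (by rwa [image_fst_graph]) (fun t p hp => hU.map_mem_graph t hp)
    (fun p hp => (hU.mem_graph_iff _ _).1 hp)
  rw [LinearPMap.isSelfAdjoint_def]
  refine LinearPMap.eq_of_eq_graph ?_
  rw [LinearPMap.adjoint_graph_eq_graph_adjoint hd]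
  ext ⟨f, η⟩
  rw [hU.mem_graph_iff, key, Submodule.mem_adjoint_iff]
  constructor
  · intro h p hp
    have := h p.1 p.2 hp
    rw [sub_eq_zero] at this
    exact this.symm
  · intro h a b hab
    rw [sub_eq_zero]
    exact (h (a, b) hab).symm

/-- A densely defined operator generates at most one unitary group. -/
theorem unique {V : ℝ → X →L[ℂ] X} (hU : IsUnitaryGroupOf H U) (hV : IsUnitaryGroupOf H V)
    (hd : Dense (H.domain : Set X)) : V = U := by
  have hU' := hU.isUnitaryGroup
  have hV' := hV.isUnitaryGroup
  have h1 : ∀ ψ ∈ H.domain, ∀ φ ∈ H.domain, ∀ t, inner ℂ (U t φ) (V t ψ) = inner ℂ φ ψ := by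
    intro ψ hψ φ hφ t
    have gψ := H.mem_graph ⟨ψ, hψ⟩
    have gφ := H.mem_graph ⟨φ, hφ⟩
    have hder : ∀ s, HasDerivAt (fun s => inner ℂ (U s φ) (V s ψ)) 0 s := by
      intro s
      have d1 := (hU'.hasDerivAt_apply ((hU.mem_graph_iff _ _).1 gφ) s)
      have d2 := (hV'.hasDerivAt_apply ((hV.mem_graph_iff _ _).1 gψ) s)
      refine (d1.inner ℂ d2).congr_deriv ?_
      -- Both orbits stay in the graph of the same symmetric `H`, so the two terms of the derivative
      -- cancel.
      have := (hU'.hasDerivAt_iff_forall_inner (H.graph : Set (X × X))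
        (by rwa [image_fst_graph]) (fun t p hp => hU.map_mem_graph t hp)
        (fun p hp => (hU.mem_graph_iff _ _).1 hp) _ _).1
        ((hU.mem_graph_iff _ _).1 (hV.map_mem_graph s gψ)) _ (hU.map_mem_graph s gφ)
      simp only at this
      simp [inner_smul_left, inner_smul_right, this]
    have := is_const_of_deriv_eq_zero (fun s => (hder s).differentiableAt)
      (fun s => (hder s).deriv) t 0
    simpa [hU'.apply_zero, hV'.apply_zero] using this
  ext t ψ
  suffices h : ∀ ψ ∈ H.domain, V t ψ = U t ψ from
    congrFun (Continuous.ext_on hd (V t).continuous (U t).continuous h) ψ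
  intro ψ hψ
  have h2 : U (-t) (V t ψ) = ψ := by
    refine hd.eq_of_inner_right (𝕜 := ℂ) fun φ hφ => ?_
    rw [← hU'.inner_map_left]
    exact h1 ψ hψ φ hφ t
  nth_rw 2 [← h2]
  rw [← hU'.apply_add, add_neg_cancel, hU'.apply_zero]

end IsUnitaryGroupOf

end Abstract

/-! ### Translations and the momentum operator -/

theorem coeFn_translation (t : ℝ) (f : L2R) : translation t f =ᵐ[volume] fun x => f (x - t) :=
  Lp.coeFn_compMeasurePreserving f (measurePreserving_sub_right volume t)

theorem translation_add (s t : ℝ) : translation (s + t) = translation s * translation t := by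
  ext1 f
  apply Lp.ext
  rw [mul_apply_eq_comp]
  filter_upwards [coeFn_translation (s + t) f, coeFn_translation s (translation t f),
    (measurePreserving_sub_right volume s).quasiMeasurePreserving.ae (coeFn_translation t f)]
    with x h1 h2 h3
  rw [h1, h2, h3, sub_sub]

theorem translation_zero : translation 0 = 1 := by
  ext1 f
  apply Lp.ext
  filter_upwards [coeFn_translation 0 f] with x h1
  rw [h1, sub_zero, one_apply_eq_self]

theorem inner_translation_translation (t : ℝ) (f g : L2R) :
    inner ℂ (translation t f) (translation t g) = inner ℂ f g :=
  (Lp.compMeasurePreservingₗᵢ ℂ (fun x : ℝ => x - t)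
    (measurePreserving_sub_right volume t)).inner_map_map f g

theorem continuous_translation (f : L2R) : Continuous fun t => translation t f := by
  have hg : Continuous fun t : ℝ => (⟨fun x : ℝ => x - t, by fun_prop⟩ : C(ℝ, ℝ)) :=
    ContinuousMap.continuous_of_continuous_uncurry _ (continuous_snd.sub continuous_fst)
  exact (continuous_const (y := f)).compMeasurePreservingLp hg
    (fun t => measurePreserving_sub_right volume t) (by simp)

theorem isUnitaryGroup_translation : IsUnitaryGroup translation where
  unitary t := by
    have h : star (translation t) * translation t = 1 := by
      ext1 f
      refine ext_inner_left ℂ fun g => ?_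
      rw [mul_apply_eq_comp, ContinuousLinearMap.star_eq_adjoint,
        ContinuousLinearMap.adjoint_inner_right, inner_translation_translation, one_apply_eq_self]
    have h2 : translation t * translation (-t) = 1 := by
      rw [← translation_add, add_neg_cancel, translation_zero]
    have h3 : star (translation t) = translation (-t) := by
      rw [← mul_one (star _), ← h2, ← mul_assoc, h, one_mul]
    exact Unitary.mem_iff.2 ⟨h, by rw [h3, h2]⟩
  zero := translation_zero
  add := translation_add
  continuous := continuous_translation

/-- First-order Taylor estimate for Schwartz functions, with an integrable remainder. -/
theorem _root_.SchwartzMap.exists_norm_sub_taylor_le (φ : 𝓢(ℝ, ℂ)) :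
    ∃ C : ℝ, ∀ x t : ℝ, |t| ≤ 1 →
      ‖φ (x - t) - φ x - t • (-deriv φ x)‖ ≤ C * t ^ 2 * (1 + x ^ 2)⁻¹ := by
  set φ' := SchwartzMap.derivCLM ℂ ℂ φ with hφ'
  set φ'' := SchwartzMap.derivCLM ℂ ℂ φ' with hφ''
  set C := SchwartzMap.seminorm ℂ 0 0 φ'' + SchwartzMap.seminorm ℂ 2 0 φ'' with hC
  have hb : ∀ y, ‖φ'' y‖ ≤ C * (1 + y ^ 2)⁻¹ := by
    intro y
    have h0 := SchwartzMap.le_seminorm' ℂ 0 0 φ'' y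
    have h2 := SchwartzMap.le_seminorm' ℂ 2 0 φ'' y
    simp only [pow_zero, one_mul, iteratedDeriv_zero, sq_abs] at h0 h2
    rw [← div_eq_mul_inv, le_div_iff₀ (by positivity), hC]
    linarith
  have hC0 : 0 ≤ C := by positivity
  -- The factor `3` comes from `1 + x² ≤ 3 (1 + y²)` when `|x - y| ≤ 1`; it moves the decay from
  -- intermediate points back to `x`.
  refine ⟨3 * C, fun x t ht => ?_⟩
  have hb' : ∀ y ∈ Set.Icc (x - |t|) (x + |t|), ‖φ'' y‖ ≤ 3 * C * (1 + x ^ 2)⁻¹ := by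
    intro y hy
    refine (hb y).trans ?_
    rw [← div_eq_mul_inv, ← div_eq_mul_inv, div_le_div_iff₀ (by positivity) (by positivity)]
    have h1 : (x - y) ^ 2 ≤ 1 := by
      rw [sq_le_one_iff_abs_le_one, abs_le]
      constructor <;> linarith [hy.1, hy.2]
    nlinarith [mul_nonneg hC0 (sub_nonneg.2 h1), mul_nonneg hC0 (sq_nonneg (x - 2 * y))]
  set M := 3 * C * (1 + x ^ 2)⁻¹
  have hd : ∀ y ∈ Set.Icc (x - |t|) (x + |t|), ‖φ' y - φ' x‖ ≤ M * |t| := by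
    intro y hy
    have hx : x ∈ Set.Icc (x - |t|) (x + |t|) :=
      ⟨by linarith [abs_nonneg t], by linarith [abs_nonneg t]⟩
    have := (convex_Icc (x - |t|) (x + |t|)).norm_image_sub_le_of_norm_hasDerivWithin_le
      (fun y _ => (φ'.hasDerivAt y).hasDerivWithinAt) hb' hx hy
    refine this.trans ?_
    have hM : 0 ≤ M := by positivity
    gcongr
    rw [Real.norm_eq_abs, abs_le]
    constructor <;> linarith [hy.1, hy.2]
  have hg : ∀ s, HasDerivAt (fun s : ℝ => φ (x - s) - s • (-deriv φ x))
      (-φ' (x - s) - (-φ' x)) s := by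
    intro s
    have h1 : HasDerivAt (fun s : ℝ => φ (x - s)) (-φ' (x - s)) s := by
      have := (φ.hasDerivAt (x - s)).scomp s ((hasDerivAt_id s).const_sub x)
      simpa [Function.comp_def, hφ'] using this
    have h2 := (hasDerivAt_id s).smul_const (-deriv φ x)
    simp only [one_smul, id] at h2
    exact h1.sub h2
  have := (convex_Icc (-|t|) |t|).norm_image_sub_le_of_norm_hasDerivWithin_le
      (C := M * |t|) (x := 0) (y := t) (fun s _ => (hg s).hasDerivWithinAt) (fun s hs => by
        rw [neg_sub_neg, ← norm_neg, neg_sub]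
        exact hd _ ⟨by linarith [hs.2], by linarith [hs.1]⟩)
      ⟨by linarith [abs_nonneg t], abs_nonneg t⟩ ⟨neg_abs_le t, le_abs_self t⟩
  simp only [sub_zero, zero_smul, Real.norm_eq_abs] at this
  calc ‖φ (x - t) - φ x - t • (-deriv φ x)‖
      = ‖φ (x - t) - t • (-deriv φ x) - φ x‖ := by congr 1; abel
    _ ≤ M * |t| * |t| := this
    _ = 3 * C * t ^ 2 * (1 + x ^ 2)⁻¹ := by
      rw [mul_assoc, abs_mul_abs_self]
      ring

theorem memLp_inv_one_add_sq : MemLp (fun x : ℝ => (1 + x ^ 2)⁻¹) 2 volume := by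
  have hc : Continuous fun x : ℝ => (1 + x ^ 2)⁻¹ :=
    Continuous.inv₀ (by fun_prop) fun x => by positivity
  rw [memLp_two_iff_integrable_sq hc.aestronglyMeasurable]
  refine integrable_inv_one_add_sq.mono' (hc.pow 2).aestronglyMeasurable (ae_of_all _ fun x => ?_)
  have h1 : (1 + x ^ 2)⁻¹ ≤ 1 := inv_le_one_of_one_le₀ (by nlinarith [sq_nonneg x])
  have h0 : 0 ≤ (1 + x ^ 2)⁻¹ := by positivity
  rw [Real.norm_eq_abs, abs_of_nonneg (by positivity)]
  nlinarith

/-- The Taylor remainder is at most `C t²` times a fixed `L²` function, hence `O(t²)` in norm. -/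
theorem hasDerivAt_translation_schwartz (φ : 𝓢(ℝ, ℂ)) :
    HasDerivAt (fun t => translation t (φ.toLp 2 volume))
      (-(SchwartzMap.derivCLM ℂ ℂ φ).toLp 2 volume) 0 := by
  obtain ⟨C, hC⟩ := φ.exists_norm_sub_taylor_le
  rw [hasDerivAt_iff_isLittleO_nhds_zero]
  set w : Lp ℝ 2 (volume : Measure ℝ) := memLp_inv_one_add_sq.toLp _ with hw
  refine Asymptotics.IsBigO.trans_isLittleO (g := fun h : ℝ => h ^ 2) ?_
    (by simpa using Asymptotics.isLittleO_pow_pow (𝕜 := ℝ) one_lt_two)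
  refine Asymptotics.IsBigO.of_bound (C * ‖w‖) ?_
  have hnb : ∀ᶠ t : ℝ in 𝓝 0, |t| ≤ 1 := by
    filter_upwards [Icc_mem_nhds (show (-1 : ℝ) < 0 by norm_num) one_pos] with t ht
    exact abs_le.2 ht
  filter_upwards [hnb] with t ht
  have h1 : ‖translation (0 + t) (φ.toLp 2 volume) - translation 0 (φ.toLp 2 volume)
      - t • (-(SchwartzMap.derivCLM ℂ ℂ φ).toLp 2 volume)‖ ≤ C * t ^ 2 * ‖w‖ := by
    refine Lp.norm_le_mul_norm_of_ae_le_mul ?_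
    rw [zero_add, translation_zero, one_apply_eq_self, smul_neg, sub_neg_eq_add]
    filter_upwards [Lp.coeFn_add (translation t (φ.toLp 2 volume) - φ.toLp 2 volume)
        (t • (SchwartzMap.derivCLM ℂ ℂ φ).toLp 2 volume),
      Lp.coeFn_sub (translation t (φ.toLp 2 volume)) (φ.toLp 2 volume),
      Lp.coeFn_smul t ((SchwartzMap.derivCLM ℂ ℂ φ).toLp 2 volume),
      coeFn_translation t (φ.toLp 2 volume), φ.coeFn_toLp 2 volume,
      (measurePreserving_sub_right volume t).quasiMeasurePreserving.ae (φ.coeFn_toLp 2 volume),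
      (SchwartzMap.derivCLM ℂ ℂ φ).coeFn_toLp 2 volume, memLp_inv_one_add_sq.coeFn_toLp]
      with x e1 e2 e3 e4 e5 e6 e7 e8
    rw [e1, Pi.add_apply, e2, Pi.sub_apply, e3, Pi.smul_apply, e4, e5, e6, e7, hw, e8,
      SchwartzMap.derivCLM_apply, Real.norm_of_nonneg (by positivity)]
    have := hC x t ht
    rwa [smul_neg, sub_neg_eq_add] at this
  calc _ ≤ C * t ^ 2 * ‖w‖ := h1
    _ = C * ‖w‖ * ‖t ^ 2‖ := by
      rw [Real.norm_of_nonneg (sq_nonneg t)]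
      ring

/-! ### The distributional derivative as an adjoint on Schwartz functions -/

/-- The pairs `(φ, -i φ')` with `φ` a Schwartz function. -/
def schwartzGraph : Set (L2R × L2R) :=
  Set.range fun φ : 𝓢(ℝ, ℂ) =>
    (φ.toLp 2 volume, -Complex.I • (SchwartzMap.derivCLM ℂ ℂ φ).toLp 2 volume)

/-- Complex conjugation of Schwartz functions. -/
def conjSchwartz (φ : 𝓢(ℝ, ℂ)) : 𝓢(ℝ, ℂ) :=
  φ.postcompCLM (Complex.conjCLE : ℂ →L[ℝ] ℂ)

theorem conjSchwartz_apply (φ : 𝓢(ℝ, ℂ)) (x : ℝ) :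
    conjSchwartz φ x = (starRingEnd ℂ) (φ x) := rfl

theorem conjSchwartz_conjSchwartz (φ : 𝓢(ℝ, ℂ)) : conjSchwartz (conjSchwartz φ) = φ := by
  ext x
  simp [conjSchwartz_apply]

theorem derivCLM_conjSchwartz (φ : 𝓢(ℝ, ℂ)) :
    SchwartzMap.derivCLM ℂ ℂ (conjSchwartz φ) = conjSchwartz (SchwartzMap.derivCLM ℂ ℂ φ) := by
  ext x
  exact ((Complex.conjCLE : ℂ →L[ℝ] ℂ).hasFDerivAt.comp_hasDerivAt x (φ.hasDerivAt x)).deriv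

/-- Conjugating the test function turns the sesquilinear inner product into the bilinear
distributional pairing. -/
theorem inner_schwartz (φ : 𝓢(ℝ, ℂ)) (f : L2R) :
    inner ℂ (φ.toLp 2 volume) f = Lp.toTemperedDistributionCLM ℂ volume 2 f (conjSchwartz φ) := by
  rw [L2.inner_def, Lp.toTemperedDistributionCLM_apply, Lp.toTemperedDistribution_apply]
  refine integral_congr_ae ?_
  filter_upwards [φ.coeFn_toLp 2] with x hx
  rw [hx, conjSchwartz_apply, RCLike.inner_apply, smul_eq_mul, mul_comm]

/-- Conjugation is an involution of Schwartz space, so testing with all `conjSchwartz φ` is testing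
with every Schwartz function. Thus the distributional operator is the adjoint of `-i d/dx` on
Schwartz functions. -/
theorem mem_momentumGraph_iff_inner (f η : L2R) :
    (f, η) ∈ momentumGraph ↔ ∀ p ∈ schwartzGraph, inner ℂ p.1 η = inner ℂ p.2 f := by
  have h1 : (f, η) ∈ momentumGraph ↔ derivCLM ℂ (Lp.toTemperedDistributionCLM ℂ volume 2 f) =
    Lp.toTemperedDistributionCLM ℂ volume 2 (Complex.I • η) := Iff.rfl
  have h2 : ∀ φ, derivCLM ℂ (Lp.toTemperedDistributionCLM ℂ volume 2 f) (conjSchwartz φ) =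
      Lp.toTemperedDistributionCLM ℂ volume 2 (Complex.I • η) (conjSchwartz φ) ↔
      inner ℂ (φ.toLp 2 volume) η =
        inner ℂ (-Complex.I • (SchwartzMap.derivCLM ℂ ℂ φ).toLp 2 volume) f := by
    intro φ
    rw [derivCLM_apply_apply, map_neg, derivCLM_conjSchwartz, ← inner_schwartz, ← inner_schwartz,
      inner_smul_left, inner_smul_right, map_neg, Complex.conj_I, neg_neg]
    constructor
    · intro h
      linear_combination Complex.I * h + (inner ℂ (φ.toLp 2 volume) η : ℂ) * Complex.I_mul_I
    · intro h
      linear_combination (-Complex.I) * h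
        - (inner ℂ ((SchwartzMap.derivCLM ℂ ℂ φ).toLp 2 volume) f : ℂ) * Complex.I_mul_I
  rw [h1]
  constructor
  · rintro h _ ⟨φ, rfl⟩
    exact (h2 φ).1 (by rw [h])
  · intro h
    ext φ
    have := (h2 (conjSchwartz φ)).2 (h _ ⟨_, rfl⟩)
    rwa [conjSchwartz_conjSchwartz] at this

theorem translation_mem_schwartzGraph (t : ℝ) (p : L2R × L2R) (hp : p ∈ schwartzGraph) :
    (translation t p.1, translation t p.2) ∈ schwartzGraph := by
  obtain ⟨φ, rfl⟩ := hp
  set ψ : 𝓢(ℝ, ℂ) := SchwartzMap.compCLMOfAntilipschitz ℂ (K := 1) (g := fun x : ℝ => x - t)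
    (by fun_prop) (AntilipschitzWith.of_le_mul_dist fun x y => by simp) φ with hψ
  have hψ' : ∀ x, ψ x = φ (x - t) := fun x => rfl
  have hd : ∀ x, SchwartzMap.derivCLM ℂ ℂ ψ x = SchwartzMap.derivCLM ℂ ℂ φ (x - t) := by
    intro x
    rw [SchwartzMap.derivCLM_apply, SchwartzMap.derivCLM_apply,
      show (ψ : ℝ → ℂ) = fun x => φ (x - t) from funext hψ', deriv_comp_sub_const]
  refine ⟨ψ, ?_⟩
  have key : ∀ α β : 𝓢(ℝ, ℂ), (∀ x, α x = β (x - t)) →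
      α.toLp 2 volume = translation t (β.toLp 2 volume) := by
    intro α β h
    apply Lp.ext
    filter_upwards [α.coeFn_toLp 2 volume, coeFn_translation t (β.toLp 2 volume),
      (measurePreserving_sub_right volume t).quasiMeasurePreserving.ae (β.coeFn_toLp 2 volume)]
      with x e1 e2 e3
    rw [e1, e2, e3, h]
  simp only [map_smul]
  rw [key ψ φ hψ', key _ _ hd]

theorem dense_schwartz : Dense (Prod.fst '' schwartzGraph) := by
  have h := SchwartzMap.denseRange_toLpCLM (E := ℝ) (F := ℂ) (p := 2) (μ := volume) (by simp)
  refine h.mono ?_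
  rintro _ ⟨φ, rfl⟩
  exact ⟨_, ⟨φ, rfl⟩, rfl⟩

/-- Both sides amount to the same duality condition against `schwartzGraph`. -/
theorem hasDerivAt_translation_iff (f η : L2R) :
    HasDerivAt (fun t => translation t f) (-Complex.I • η) 0 ↔ (f, η) ∈ momentum.graph := by
  rw [momentum_graph, mem_momentumGraph_iff_inner]
  refine isUnitaryGroup_translation.hasDerivAt_iff_forall_inner schwartzGraph dense_schwartz
    translation_mem_schwartzGraph ?_ f η
  rintro _ ⟨φ, rfl⟩
  exact (hasDerivAt_translation_schwartz φ).congr_deriv (by simp [smul_smul])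

theorem isUnitaryGroupOf_translation : IsUnitaryGroupOf momentum translation where
  unitary := isUnitaryGroup_translation.unitary
  zero := translation_zero
  add := translation_add
  continuous := continuous_translation
  generator ψ φ := by
    exact (hasDerivAt_translation_iff ψ φ).symm.trans
      (tendsto_generator_iff translation_zero ψ φ).symm

theorem dense_momentum : Dense (momentum.domain : Set L2R) := by
  refine dense_schwartz.mono ?_
  rintro _ ⟨_, ⟨φ, rfl⟩, rfl⟩
  refine LinearPMap.mem_domain_of_mem_graph
    (y := -Complex.I • (SchwartzMap.derivCLM ℂ ℂ φ).toLp 2 volume) ?_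
  rw [← hasDerivAt_translation_iff]
  exact (hasDerivAt_translation_schwartz φ).congr_deriv (by simp [smul_smul])

theorem isSelfAdjoint_momentum : IsSelfAdjoint momentum :=
  isUnitaryGroupOf_translation.isSelfAdjoint dense_momentum

theorem isUnitaryGroupOf_momentum_iff (U : ℝ → L2R →L[ℂ] L2R) :
    IsUnitaryGroupOf momentum U ↔ U = translation := by
  constructor
  · intro hU
    exact isUnitaryGroupOf_translation.unique hU dense_momentum
  · rintro rfl
    exact isUnitaryGroupOf_translation

theorem translation_mem_momentum_domain (t : ℝ) {ψ : L2R} (h : ψ ∈ momentum.domain) :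
    translation t ψ ∈ momentum.domain :=
  LinearPMap.mem_domain_of_mem_graph
    (isUnitaryGroupOf_translation.map_mem_graph t (momentum.mem_graph ⟨ψ, h⟩))

/-! ### Diagonal sums of rank-one operators -/

section RankOne

variable {X : Type*} [NormedAddCommGroup X] [InnerProductSpace ℂ X]

/-- Allows the sums for two vectors to be compared over one common finite index set. -/
theorem finsum_rankOne_eq_sum (v : ℕ → X) (c : ℕ → ℝ) (f : X) (s : Finset ℕ)
    (hs : ∀ n ∉ s, inner ℂ (v n) f = 0) :
    ∑ᶠ n, ((c n : ℂ) * inner ℂ (v n) f) • v n =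
      ∑ n ∈ s, ((c n : ℂ) * inner ℂ (v n) f) • v n := by
  refine finsum_eq_sum_of_support_subset _ fun n hn => ?_
  by_contra h
  exact hn (by simp [hs n h])

/-- The operator `f ↦ ∑ₙ cₙ ⟨vₙ, f⟩ vₙ` on a domain on which all these sums are finite. -/
def rankOneSum (D : Submodule ℂ X) (v : ℕ → X) (c : ℕ → ℝ)
    (hD : ∀ f ∈ D, {n | inner ℂ (v n) f ≠ 0}.Finite) : X →ₗ.[ℂ] X where
  domain := D
  toFun :=
    { toFun := fun f => ∑ᶠ n, ((c n : ℂ) * inner ℂ (v n) (f : X)) • v n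
      map_add' := fun f g => by
        have hf : ∀ n ∉ (hD f f.2).toFinset ∪ (hD g g.2).toFinset,
            inner ℂ (v n) (f : X) = 0 ∧ inner ℂ (v n) (g : X) = 0 := by
          intro n hn
          simpa [not_or] using hn
        rw [finsum_rankOne_eq_sum v c _ _ fun n hn => (hf n hn).1,
          finsum_rankOne_eq_sum v c _ _ fun n hn => (hf n hn).2,
          finsum_rankOne_eq_sum v c _ ((hD f f.2).toFinset ∪ (hD g g.2).toFinset) fun n hn => by
            rw [Submodule.coe_add, inner_add_right, (hf n hn).1, (hf n hn).2, add_zero],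
          ← Finset.sum_add_distrib]
        refine Finset.sum_congr rfl fun n _ => ?_
        rw [Submodule.coe_add, inner_add_right, mul_add, add_smul]
      map_smul' := fun a f => by
        have hf : ∀ n ∉ (hD f f.2).toFinset, inner ℂ (v n) (f : X) = 0 := by
          intro n hn
          simpa using hn
        rw [finsum_rankOne_eq_sum v c _ _ hf,
          finsum_rankOne_eq_sum v c _ (hD f f.2).toFinset fun n hn => by
            rw [Submodule.coe_smul, inner_smul_right, hf n hn, mul_zero], Finset.smul_sum]
        refine Finset.sum_congr rfl fun n _ => ?_
        rw [Submodule.coe_smul, inner_smul_right, RingHom.id_apply, smul_smul]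
        congr 1
        ring }

variable {D : Submodule ℂ X} {v : ℕ → X} {c : ℕ → ℝ}
  {hD : ∀ f ∈ D, {n | inner ℂ (v n) f ≠ 0}.Finite}

theorem rankOneSum_apply (f : (rankOneSum D v c hD).domain) (s : Finset ℕ)
    (hs : ∀ n ∉ s, inner ℂ (v n) (f : X) = 0) :
    rankOneSum D v c hD f = ∑ n ∈ s, ((c n : ℂ) * inner ℂ (v n) (f : X)) • v n :=
  finsum_rankOne_eq_sum v c f s hs

theorem isHermitean_rankOneSum : IsHermitean (rankOneSum D v c hD) := by
  intro f g
  have hfg : ∀ n ∉ (hD f f.2).toFinset ∪ (hD g g.2).toFinset,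
      inner ℂ (v n) (f : X) = 0 ∧ inner ℂ (v n) (g : X) = 0 := by
    intro n hn
    simpa [not_or] using hn
  rw [rankOneSum_apply f _ fun n hn => (hfg n hn).1,
    rankOneSum_apply g _ fun n hn => (hfg n hn).2, sum_inner, inner_sum]
  refine Finset.sum_congr rfl fun n _ => ?_
  rw [inner_smul_left, inner_smul_right, map_mul, Complex.conj_ofReal, inner_conj_symm]
  ring

theorem expVal_rankOneSum (f : (rankOneSum D v c hD).domain) :
    expVal (rankOneSum D v c hD) f =
      ((∑ n ∈ (hD f f.2).toFinset, c n * ‖inner ℂ (v n) (f : X)‖ ^ 2 : ℝ) : ℂ) := by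
  rw [expVal, rankOneSum_apply f (hD f f.2).toFinset (fun n hn => by simpa using hn), inner_sum,
    Complex.ofReal_sum]
  refine Finset.sum_congr rfl fun n _ => ?_
  rw [inner_smul_right, ← inner_conj_symm (f : X) (v n), mul_assoc, Complex.mul_conj,
    Complex.normSq_eq_norm_sq]
  push_cast
  ring

theorem expVal_rankOneSum_im (f : (rankOneSum D v c hD).domain) :
    (expVal (rankOneSum D v c hD) f).im = 0 := by
  rw [expVal_rankOneSum, Complex.ofReal_im]

theorem le_expVal_rankOneSum (hc : ∀ n, 0 ≤ c n) (f : (rankOneSum D v c hD).domain) (n : ℕ)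
    (hn : inner ℂ (v n) (f : X) ≠ 0) :
    c n * ‖inner ℂ (v n) (f : X)‖ ^ 2 ≤ (expVal (rankOneSum D v c hD) f).re := by
  rw [expVal_rankOneSum, Complex.ofReal_re]
  exact Finset.single_le_sum (f := fun n => c n * ‖inner ℂ (v n) (f : X)‖ ^ 2)
    (fun m _ => mul_nonneg (hc m) (sq_nonneg _)) (by simpa using hn)

end RankOne

/-! ### Indicators of intervals -/

/-- The indicator function of `(a, b]`. -/
def box (a b : ℝ) : L2R :=
  indicatorConstLp 2 (measurableSet_Ioc (a := a) (b := b)) measure_Ioc_lt_top.ne (1 : ℂ)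

theorem coeFn_box (a b : ℝ) : box a b =ᵐ[volume] (Set.Ioc a b).indicator fun _ => (1 : ℂ) :=
  indicatorConstLp_coeFn

theorem inner_box (a b : ℝ) (f : L2R) : inner ℂ (box a b) f = ∫ x in Set.Ioc a b, f x :=
  L2.inner_indicatorConstLp_one _ _ f

theorem translation_box (t a b : ℝ) : translation t (box a b) = box (a + t) (b + t) := by
  apply Lp.ext
  filter_upwards [coeFn_translation t (box a b), coeFn_box (a + t) (b + t),
    (measurePreserving_sub_right volume t).quasiMeasurePreserving.ae (coeFn_box a b)]
    with x h1 h2 h3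
  rw [h1, h2, h3]
  simp only [Set.indicator, Set.mem_Ioc]
  congr 1
  rw [lt_sub_iff_add_lt, sub_le_iff_le_add]

theorem setIntegral_Ioc_eq_sub {P G f : ℝ → ℂ} (hP : ∀ z, HasDerivAt P (G z) z)
    (hG : Continuous G) {x y : ℝ} (hxy : x ≤ y)
    (hf : ∀ᵐ z, z ∈ Set.Ioo x y → f z = G z) : ∫ z in Set.Ioc x y, f z = P y - P x := by
  rw [integral_Ioc_eq_integral_Ioo, setIntegral_congr_ae measurableSet_Ioo hf,
    ← integral_Ioc_eq_integral_Ioo, ← intervalIntegral.integral_of_le hxy]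
  exact intervalIntegral.integral_eq_sub_of_hasDerivAt (fun z _ => hP z)
    (hG.intervalIntegrable _ _)

/-- Functions in `L²` that vanish outside an open set are approximated by linear combinations of
indicators of intervals in that set. -/
theorem mem_closure_span_box {J : Set ℝ} (hJ : IsOpen J) (f : L2R)
    (hf : ∀ᵐ x, x ∉ J → f x = 0) :
    f ∈ (Submodule.span ℂ {g | ∃ a b, Set.Icc a b ⊆ J ∧ box a b = g}).topologicalClosure := by
  -- It suffices that every `h` orthogonal to the boxes in `J` vanishes a.e. on `J`: its primitive
  -- is locally constant there, and Lebesgue differentiation recovers `h`.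
  rw [← Submodule.orthogonal_orthogonal_eq_closure, Submodule.mem_orthogonal]
  intro h hh
  have h0 : ∀ a b, a ≤ b → Set.Icc a b ⊆ J → ∫ x in a..b, h x = 0 := by
    intro a b hab hs
    rw [intervalIntegral.integral_of_le hab, ← inner_box]
    exact (Submodule.mem_orthogonal _ _).1 hh _ (Submodule.subset_span ⟨a, b, hs, rfl⟩)
  have hloc : LocallyIntegrable h volume := (Lp.memLp h).locallyIntegrable (by norm_num)
  have hae : ∀ᵐ x, x ∈ J → h x = 0 := by
    filter_upwards [_root_.LocallyIntegrable.ae_hasDerivAt_integral hloc] with x hx hxJ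
    obtain ⟨ε, hε, hball⟩ := Metric.isOpen_iff.1 hJ x hxJ
    refine (hx x).unique ((hasDerivAt_const x (0 : ℂ)).congr_of_eventuallyEq ?_)
    filter_upwards [Metric.ball_mem_nhds x hε] with y hy
    have hsub : Set.uIcc x y ⊆ J := by
      refine Set.Subset.trans ?_ hball
      rw [Real.ball_eq_Ioo] at hy ⊢
      exact Set.OrdConnected.uIcc_subset Set.ordConnected_Ioo
        ⟨by linarith, by linarith⟩ hy
    rcases le_total x y with hxy | hxy
    · exact h0 x y hxy (by rwa [Set.uIcc_of_le hxy] at hsub)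
    · rw [intervalIntegral.integral_symm, h0 y x hxy (by rwa [Set.uIcc_of_ge hxy] at hsub),
        neg_zero]
  rw [L2.inner_def]
  refine integral_eq_zero_of_ae ?_
  filter_upwards [hae, hf] with x h1 h2
  by_cases hx : x ∈ J
  · simp [h1 hx]
  · simp [h2 hx]

/-! ### The tent function -/

theorem coeFn_tent : tent =ᵐ[volume] fun x => (tentFun x : ℂ) := memLp_tentFun.coeFn_toLp

theorem tentFun_of_nonpos {x : ℝ} (h : x ≤ 0) : tentFun x = 0 := by
  rw [tentFun, abs_of_nonpos (by linarith), max_eq_left (by linarith)]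

theorem tentFun_of_le_one {x : ℝ} (h0 : 0 ≤ x) (h : x ≤ 1) : tentFun x = x := by
  rw [tentFun, abs_of_nonpos (by linarith), max_eq_right (by linarith)]
  ring

theorem tentFun_of_one_le {x : ℝ} (h0 : 1 ≤ x) (h : x ≤ 2) : tentFun x = 2 - x := by
  rw [tentFun, abs_of_nonneg (by linarith), max_eq_right (by linarith)]
  ring

theorem tentFun_of_two_le {x : ℝ} (h : 2 ≤ x) : tentFun x = 0 := by
  rw [tentFun, abs_of_nonneg (by linarith), max_eq_left (by linarith)]

theorem inner_tent (φ : L2R) : inner ℂ tent φ =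
    (∫ x in Set.Ioc (0 : ℝ) 1, (x : ℂ) * φ x) + ∫ x in Set.Ioc (1 : ℝ) 2, (2 - x : ℂ) * φ x := by
  have h1 : inner ℂ tent φ = ∫ x, (tentFun x : ℂ) * φ x := by
    rw [L2.inner_def]
    refine integral_congr_ae ?_
    filter_upwards [coeFn_tent] with x hx
    rw [hx, RCLike.inner_apply, Complex.conj_ofReal, mul_comm]
  have hint : Integrable (fun x => (tentFun x : ℂ) * φ x) volume := by
    simpa [Pi.mul_def] using memLp_tentFun.integrable_mul (Lp.memLp φ)
  have h2 : ∫ x, (tentFun x : ℂ) * φ x = ∫ x in Set.Ioc (0 : ℝ) 2, (tentFun x : ℂ) * φ x := by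
    refine (setIntegral_eq_integral_of_forall_compl_eq_zero fun x hx => ?_).symm
    rw [Set.mem_Ioc, not_and_or, not_lt, not_le] at hx
    rcases hx with hx | hx
    · rw [tentFun_of_nonpos hx, Complex.ofReal_zero, zero_mul]
    · rw [tentFun_of_two_le hx.le, Complex.ofReal_zero, zero_mul]
  rw [h1, h2, ← Set.Ioc_union_Ioc_eq_Ioc (zero_le_one' ℝ) one_le_two,
    setIntegral_union (Set.Ioc_disjoint_Ioc_of_le le_rfl) measurableSet_Ioc hint.integrableOn
      hint.integrableOn]
  congr 1
  · refine setIntegral_congr_fun measurableSet_Ioc fun x hx => ?_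
    simp only [tentFun_of_le_one hx.1.le hx.2]
  · refine setIntegral_congr_fun measurableSet_Ioc fun x hx => ?_
    simp only [tentFun_of_one_le hx.1.le hx.2]
    push_cast
    rfl

/-- Integration by parts on each affine piece: the boundary terms at `0` and `2` vanish and those at
`1` cancel. -/
theorem inner_tent_derivCLM (φ : 𝓢(ℝ, ℂ)) :
    inner ℂ tent ((SchwartzMap.derivCLM ℂ ℂ φ).toLp 2 volume) =
      -inner ℂ (box 0 1 - box 1 2) (φ.toLp 2 volume) := by
  have hφ : Continuous φ := φ.continuous
  have hφ' : Continuous (SchwartzMap.derivCLM ℂ ℂ φ) := (SchwartzMap.derivCLM ℂ ℂ φ).continuous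
  have e1 : ∀ (x y : ℝ) (u : ℝ → ℂ), x ≤ y →
      ∫ z in Set.Ioc x y, u z * (SchwartzMap.derivCLM ℂ ℂ φ).toLp 2 volume z =
      ∫ z in x..y, u z * SchwartzMap.derivCLM ℂ ℂ φ z := by
    intro x y u hxy
    rw [intervalIntegral.integral_of_le hxy]
    refine setIntegral_congr_ae measurableSet_Ioc ?_
    filter_upwards [(SchwartzMap.derivCLM ℂ ℂ φ).coeFn_toLp 2 volume] with z hz _
    rw [hz]
  have e2 : ∀ (x y : ℝ), x ≤ y →
      ∫ z in Set.Ioc x y, φ.toLp 2 volume z = ∫ z in x..y, φ z := by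
    intro x y hxy
    rw [intervalIntegral.integral_of_le hxy]
    refine setIntegral_congr_ae measurableSet_Ioc ?_
    filter_upwards [φ.coeFn_toLp 2 volume] with z hz _
    rw [hz]
  have hu : ∀ x : ℝ, HasDerivAt (fun x : ℝ => (x : ℂ)) 1 x := fun x =>
    (hasDerivAt_id x).ofReal_comp
  have i1 := intervalIntegral.integral_mul_deriv_eq_deriv_mul (a := 0) (b := 1)
    (u := fun x : ℝ => (x : ℂ)) (u' := fun _ => 1) (v := φ) (v' := SchwartzMap.derivCLM ℂ ℂ φ)
    (fun x _ => hu x) (fun x _ => φ.hasDerivAt x) (by simp) (hφ'.intervalIntegrable _ _)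
  have i2 := intervalIntegral.integral_mul_deriv_eq_deriv_mul (a := 1) (b := 2)
    (u := fun x : ℝ => (2 - x : ℂ)) (u' := fun _ => -1) (v := φ)
    (v' := SchwartzMap.derivCLM ℂ ℂ φ)
    (fun x _ => (hu x).const_sub 2) (fun x _ => φ.hasDerivAt x) (by simp)
    (hφ'.intervalIntegrable _ _)
  rw [inner_tent, inner_sub_left, inner_box, inner_box, e1 _ _ _ zero_le_one, e1 _ _ _ one_le_two,
    e2 _ _ zero_le_one, e2 _ _ one_le_two, i1, i2]
  simp only [Complex.ofReal_one, Complex.ofReal_zero, Complex.ofReal_ofNat, one_mul, neg_mul,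
    intervalIntegral.integral_neg]
  ring

theorem tent_mem_momentum_domain : tent ∈ momentum.domain := by
  refine LinearPMap.mem_domain_of_mem_graph (y := -Complex.I • (box 0 1 - box 1 2)) ?_
  rw [momentum_graph, mem_momentumGraph_iff_inner]
  rintro _ ⟨φ, rfl⟩
  rw [← inner_conj_symm, ← inner_conj_symm _ tent]
  congr 1
  rw [inner_smul_left, inner_smul_right, inner_tent_derivCLM, map_neg, Complex.conj_I]
  ring

/-! ### Step functions orthogonal to affine functions -/

/-- A step function on `(a, a + 4h]` that is orthogonal to all affine functions. -/
def haar (a h : ℝ) : L2R :=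
  box a (a + h) - box (a + h) (a + 3 * h) + box (a + 3 * h) (a + 4 * h)

theorem inner_haar (a h : ℝ) (f : L2R) : inner ℂ (haar a h) f =
    (∫ x in Set.Ioc a (a + h), f x) - (∫ x in Set.Ioc (a + h) (a + 3 * h), f x) +
      ∫ x in Set.Ioc (a + 3 * h) (a + 4 * h), f x := by
  rw [haar, inner_add_left, inner_sub_left, inner_box, inner_box, inner_box]

theorem inner_haar_translation (a h t : ℝ) (f : L2R) :
    inner ℂ (haar a h) (translation t f) = inner ℂ (haar (a - t) h) f := by
  have e : translation t (haar (a - t) h) = haar a h := by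
    rw [haar, haar, map_add, map_sub, translation_box, translation_box, translation_box]
    ring_nf
  rw [← e, inner_translation_translation]

theorem inner_haar_eq_of_primitive {P G : ℝ → ℂ} (hP : ∀ z, HasDerivAt P (G z) z)
    (hG : Continuous G) {a h : ℝ} (hh : 0 ≤ h) (f : L2R)
    (hf : ∀ᵐ z, z ∈ Set.Ioo a (a + 4 * h) → f z = G z) :
    inner ℂ (haar a h) f = P (a + 4 * h) - 2 * P (a + 3 * h) + 2 * P (a + h) - P a := by
  have key : ∀ x y, a ≤ x → y ≤ a + 4 * h → x ≤ y → ∫ z in Set.Ioc x y, f z = P y - P x := by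
    intro x y hx hy hxy
    refine setIntegral_Ioc_eq_sub hP hG hxy ?_
    filter_upwards [hf] with z hz hzxy
    exact hz ⟨hx.trans_lt hzxy.1, hzxy.2.trans_le hy⟩
  rw [inner_haar, key _ _ (by linarith) (by linarith) (by linarith),
    key _ _ (by linarith) (by linarith) (by linarith),
    key _ _ (by linarith) (by linarith) (by linarith)]
  ring

/-- The weights `-1, 2, -2, 1` at `a, a + h, a + 3h, a + 4h` annihilate quadratic polynomials, in
particular primitives of affine functions. -/
theorem inner_haar_eq_zero {a h : ℝ} (hh : 0 ≤ h) (f : L2R) (α β : ℂ)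
    (hf : ∀ᵐ z, z ∈ Set.Ioo a (a + 4 * h) → f z = α + β * z) : inner ℂ (haar a h) f = 0 := by
  have hP : ∀ z : ℝ, HasDerivAt (fun z : ℝ => α * z + β * ((z : ℂ) ^ 2 / 2)) (α + β * z) z := by
    intro z
    have h1 : HasDerivAt (fun z : ℝ => (z : ℂ)) 1 z := (hasDerivAt_id z).ofReal_comp
    refine ((h1.const_mul α).add (((h1.pow 2).div_const 2).const_mul β)).congr_deriv ?_
    simp
  rw [inner_haar_eq_of_primitive hP (by fun_prop) hh f hf]
  push_cast
  ring

/-- The lengths of the steps; the intervals `(4 hₙ, 8 hₙ)` are disjoint and accumulate at `0`. -/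
def scale (n : ℕ) : ℝ := (1 / 2) ^ (n + 3)

theorem scale_pos (n : ℕ) : 0 < scale n := by
  rw [scale]
  positivity

theorem scale_le (n : ℕ) : 8 * scale n ≤ 1 := by
  have : ((1 : ℝ) / 2) ^ n ≤ 1 := pow_le_one₀ (by norm_num) (by norm_num)
  rw [scale, pow_add]
  linarith

theorem two_mul_scale_le {m n : ℕ} (h : m < n) : 2 * scale n ≤ scale m := by
  obtain ⟨k, rfl⟩ := Nat.exists_eq_add_of_lt h
  have h1 : ((1 : ℝ) / 2) ^ k ≤ 1 := pow_le_one₀ (by norm_num) (by norm_num)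
  have h2 := scale_pos m
  have h3 : scale (m + k + 1) = scale m * (1 / 2) ^ k * (1 / 2) := by
    rw [scale, scale]
    ring
  rw [h3]
  nlinarith

/-- For `m < n`, `8 hₙ ≤ 4 hₘ`, so the intervals are disjoint and at most one contains `s`. -/
theorem finite_setOf_mem_Ioo_scale (t s : ℝ) :
    {n | s ∈ Set.Ioo (t + 4 * scale n) (t + 4 * scale n + 4 * scale n)}.Finite := by
  refine Set.Subsingleton.finite fun m hm n hn => ?_
  rw [Set.mem_ofPred_eq] at hm hn
  by_contra hne
  rcases lt_or_gt_of_ne hne with h | h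
  · linarith [two_mul_scale_le h, hm.1, hn.2]
  · linarith [two_mul_scale_le h, hn.1, hm.2]

/-- The `L²` functions whose translates are orthogonal to all but finitely many of the chosen step
functions. -/
def finiteDomain : Submodule ℂ L2R where
  carrier := {f | ∀ t : ℝ, {n | inner ℂ (haar (t + 4 * scale n) (scale n)) f ≠ 0}.Finite}
  zero_mem' t := by simp
  add_mem' {f g} hf hg t := by
    refine ((hf t).union (hg t)).subset fun n hn => ?_
    by_contra h
    simp only [Set.mem_union, Set.mem_ofPred_eq, not_or, not_not] at h
    exact hn (by rw [inner_add_right, h.1, h.2, add_zero])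
  smul_mem' c f hf t := by
    refine (hf t).subset fun n hn h => hn ?_
    rw [inner_smul_right, h, mul_zero]

theorem translation_mem_finiteDomain (t : ℝ) {f : L2R} (hf : f ∈ finiteDomain) :
    translation t f ∈ finiteDomain := by
  intro s
  refine (hf (s - t)).subset fun n hn => ?_
  rw [Set.mem_ofPred_eq, inner_haar_translation] at hn
  rw [Set.mem_ofPred_eq]
  rwa [show s - t + 4 * scale n = s + 4 * scale n - t by ring]

/-- A nonzero pairing forces a point of `S` into the open support interval, and each such point
accounts for at most one index. -/
theorem mem_finiteDomain_of_piecewise_affine (f : L2R) (F : ℝ → ℂ) (hf : f =ᵐ[volume] F)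
    (S : Set ℝ) (hS : S.Finite)
    (hF : ∀ x y, (∀ s ∈ S, s ≤ x ∨ y ≤ s) →
      ∃ α β : ℂ, ∀ z : ℝ, z ∈ Set.Ioo x y → F z = α + β * z) :
    f ∈ finiteDomain := by
  intro t
  refine (hS.biUnion fun s _ => finite_setOf_mem_Ioo_scale t s).subset fun n hn => ?_
  by_contra hcon
  simp only [Set.mem_iUnion, Set.mem_ofPred_eq, not_exists, Set.mem_Ioo, not_and_or, not_lt] at hcon
  obtain ⟨α, β, h⟩ := hF (t + 4 * scale n) (t + 4 * scale n + 4 * scale n) hcon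
  refine hn (inner_haar_eq_zero (scale_pos n).le f α β ?_)
  filter_upwards [hf] with z hz hz'
  rw [hz, h z hz']

theorem box_mem_finiteDomain (a b : ℝ) : box a b ∈ finiteDomain := by
  refine mem_finiteDomain_of_piecewise_affine _ _ (coeFn_box a b) {a, b} (by simp) ?_
  intro x y h
  have ha := h a (by simp)
  have hb := h b (by simp)
  by_cases hin : a ≤ x ∧ y ≤ b
  · refine ⟨1, 0, fun z hz => ?_⟩
    have hz' : z ∈ Set.Ioc a b := ⟨hin.1.trans_lt hz.1, hz.2.le.trans hin.2⟩
    rw [Set.indicator_of_mem hz']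
    ring
  · refine ⟨0, 0, fun z hz => ?_⟩
    rw [Set.indicator_of_notMem]
    · ring
    · rintro ⟨h1, h2⟩
      refine hin ⟨ha.resolve_right fun h => ?_, hb.resolve_left fun h => ?_⟩
      · linarith [hz.2]
      · linarith [hz.1]

theorem tent_mem_finiteDomain : tent ∈ finiteDomain := by
  refine mem_finiteDomain_of_piecewise_affine _ _ coeFn_tent {0, 1, 2} (by simp) ?_
  intro x y h
  rcases h 0 (by simp) with h0 | h0
  · rcases h 1 (by simp) with h1 | h1
    · rcases h 2 (by simp) with h2 | h2
      · refine ⟨0, 0, fun z hz => ?_⟩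
        rw [tentFun_of_two_le (h2.trans hz.1.le)]
        simp
      · refine ⟨2, -1, fun z hz => ?_⟩
        rw [tentFun_of_one_le (h1.trans hz.1.le) (hz.2.le.trans h2)]
        push_cast
        ring
    · refine ⟨0, 1, fun z hz => ?_⟩
      rw [tentFun_of_le_one (h0.trans hz.1.le) (hz.2.le.trans h1)]
      ring
  · refine ⟨0, 0, fun z hz => ?_⟩
    rw [tentFun_of_nonpos (hz.2.le.trans h0)]
    simp

theorem dense_finiteDomain : Dense (finiteDomain : Set L2R) := by
  intro f
  have h := mem_closure_span_box isOpen_univ f (by simp)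
  refine closure_mono ?_ h
  refine Submodule.span_le.2 ?_
  rintro _ ⟨a, b, _, rfl⟩
  exact box_mem_finiteDomain a b

/-! ### The operator -/

theorem finite_setOf_inner_haar_ne_zero (f : L2R) (hf : f ∈ finiteDomain) :
    {n | inner ℂ (haar (4 * scale n) (scale n)) f ≠ 0}.Finite := by
  simpa only [zero_add] using hf 0

/-- A densely defined hermitean operator whose expectation is unbounded along the translates of
the tent function. -/
def haarOperator : L2R →ₗ.[ℂ] L2R :=
  rankOneSum finiteDomain (fun n => haar (4 * scale n) (scale n))
    -- The pairing at time `5hₙ` is `hₙ² / 2`; this coefficient makes the `n`-th term of the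
    -- expectation exactly `n`.
    (fun n => 4 * n / scale n ^ 4) finite_setOf_inner_haar_ne_zero

/-- The corner moves to `5hₙ`, the first sign change of the step function. The first step sees `0`
and the others a line of slope one, giving `-2h² + 5h²/2`. -/
theorem inner_haar_translation_tent (n : ℕ) :
    inner ℂ (haar (4 * scale n) (scale n)) (translation (5 * scale n) tent) =
      ((scale n ^ 2 / 2 : ℝ) : ℂ) := by
  have h0 := scale_pos n
  have h1 := scale_le n
  rw [inner_haar_translation, inner_haar]
  set h := scale n
  have hlin : ∀ z : ℝ, HasDerivAt (fun z : ℝ => (z : ℂ) ^ 2 / 2) (z : ℂ) z := by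
    intro z
    have h1 : HasDerivAt (fun z : ℝ => (z : ℂ)) 1 z := (hasDerivAt_id z).ofReal_comp
    refine ((h1.pow 2).div_const 2).congr_deriv ?_
    simp
  have key : ∀ x y, 0 ≤ x → y ≤ 1 → x ≤ y →
      ∫ z in Set.Ioc x y, tent z = (y : ℂ) ^ 2 / 2 - (x : ℂ) ^ 2 / 2 := by
    intro x y hx hy hxy
    refine setIntegral_Ioc_eq_sub hlin (by fun_prop) hxy ?_
    filter_upwards [coeFn_tent] with z hz hz'
    rw [hz, tentFun_of_le_one (hx.trans hz'.1.le) (hz'.2.le.trans hy)]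
  have hz : ∫ z in Set.Ioc (4 * h - 5 * h) (4 * h - 5 * h + h), tent z = 0 := by
    rw [setIntegral_Ioc_eq_sub (P := fun _ => 0) (G := fun _ => 0)
      (fun z => hasDerivAt_const z 0) continuous_const (by linarith), sub_zero]
    filter_upwards [coeFn_tent] with z hz hz'
    rw [hz, tentFun_of_nonpos (by linarith [hz'.2]), Complex.ofReal_zero]
  rw [hz, key _ _ (by linarith) (by linarith) (by linarith),
    key _ _ (by linarith) (by linarith) (by linarith)]
  push_cast
  ring

theorem haarOperator_not_isClosed : ¬ haarOperator.IsClosed := by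
  intro hcl
  set F : ℝ → ℂ := (Set.Ioo (10 : ℝ) 11).indicator fun x => (x : ℂ) ^ 2 with hF
  have hmem : MemLp F 2 volume := by
    rw [hF, memLp_indicator_iff_restrict measurableSet_Ioo]
    refine MemLp.of_bound (by fun_prop) (11 ^ 2) ?_
    filter_upwards [ae_restrict_mem measurableSet_Ioo] with x hx
    rw [norm_pow, Complex.norm_real, Real.norm_of_nonneg (by linarith [hx.1])]
    exact pow_le_pow_left₀ (by linarith [hx.1]) hx.2.le 2
  set f : L2R := hmem.toLp F with hf
  have hfF : f =ᵐ[volume] F := hmem.coeFn_toLp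
  -- If the graph were closed, the vectors that `A` sends to `0` would form a closed subspace
  -- containing all boxes in `(10, 11)`, whereas the step functions defining `A` live in `(0, 1]`.
  let K : Submodule ℂ L2R := haarOperator.graph.comap (LinearMap.inl ℂ L2R L2R)
  have hK : IsClosed (K : Set L2R) :=
    IsClosed.preimage (f := fun x : L2R => (x, (0 : L2R))) (by fun_prop) hcl
  have hspan : Submodule.span ℂ {g | ∃ a b, Set.Icc a b ⊆ Set.Ioo (10 : ℝ) 11 ∧ box a b = g}
      ≤ K := by
    rw [Submodule.span_le]
    rintro _ ⟨a, b, hab, rfl⟩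
    change (box a b, (0 : L2R)) ∈ haarOperator.graph
    rw [LinearPMap.mem_graph_iff]
    refine ⟨⟨box a b, box_mem_finiteDomain a b⟩, rfl, ?_⟩
    refine (rankOneSum_apply _ ∅ fun n _ => ?_).trans Finset.sum_empty
    refine inner_haar_eq_zero (scale_pos n).le _ 0 0 ?_
    filter_upwards [coeFn_box a b] with z hz hz'
    rw [hz, Set.indicator_of_notMem]
    · ring
    · rintro ⟨h1, h2⟩
      have := (hab ⟨le_rfl, h1.le.trans h2⟩).1
      linarith [scale_le n, hz'.2]
  have hfK : f ∈ K := by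
    refine Submodule.topologicalClosure_minimal _ hspan hK (mem_closure_span_box isOpen_Ioo f ?_)
    filter_upwards [hfF] with x hx hx'
    rw [hx, hF, Set.indicator_of_notMem hx']
  have hfD : f ∈ finiteDomain :=
    LinearPMap.mem_domain_of_mem_graph (f := haarOperator) (y := 0) hfK
  -- At shift `10` every step function lies where `f = x²`, and each pairing is `4 hₙ³ ≠ 0`.
  refine Set.infinite_univ ((hfD 10).subset fun n _ => ?_)
  have h0 := scale_pos n
  have h1 := scale_le n
  have hP : ∀ z : ℝ, HasDerivAt (fun z : ℝ => (z : ℂ) ^ 3 / 3) ((z : ℂ) ^ 2) z := by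
    intro z
    have h1 : HasDerivAt (fun z : ℝ => (z : ℂ)) 1 z := (hasDerivAt_id z).ofReal_comp
    refine ((h1.pow 3).div_const 3).congr_deriv ?_
    simp
  rw [Set.mem_ofPred_eq, inner_haar_eq_of_primitive hP (by fun_prop) h0.le]
  · have : ((4 * scale n ^ 3 : ℝ) : ℂ) ≠ 0 := Complex.ofReal_ne_zero.2 (by positivity)
    convert this using 1
    push_cast
    ring
  · filter_upwards [hfF] with z hz hz'
    rw [hz, hF, Set.indicator_of_mem]
    exact ⟨by linarith [hz'.1], by linarith [hz'.2]⟩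

theorem weakHypotheses_haarOperator : WeakHypotheses momentum haarOperator translation where
  selfAdjoint := isSelfAdjoint_momentum
  dense_H := dense_momentum
  group := isUnitaryGroupOf_translation
  dense_A := dense_finiteDomain
  hermitean := isHermitean_rankOneSum
  invariant t _ hψ :=
    ⟨translation_mem_finiteDomain t hψ.1, translation_mem_momentum_domain t hψ.2⟩

theorem exists_lt_expVal_haarOperator
    (h : ∀ t, translation t tent ∈ haarOperator.domain) (C : ℝ) :
    ∃ t ∈ Set.Ioo (0 : ℝ) 1, C < (expVal haarOperator ⟨translation t tent, h t⟩).re := by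
  obtain ⟨n, hn⟩ := exists_nat_gt C
  have h0 := scale_pos n
  have h1 := scale_le n
  refine ⟨5 * scale n, ⟨by linarith, by linarith⟩, hn.trans_le ?_⟩
  have hv := inner_haar_translation_tent n
  have hne : inner ℂ (haar (4 * scale n) (scale n)) (translation (5 * scale n) tent) ≠ 0 := by
    rw [hv]
    exact Complex.ofReal_ne_zero.2 (by positivity)
  refine le_trans (le_of_eq ?_) (le_expVal_rankOneSum (fun m => ?_)
    (⟨translation (5 * scale n) tent, h _⟩ : haarOperator.domain) n hne)
  · rw [hv, Complex.norm_real, Real.norm_of_nonneg (by positivity)]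
    field_simp
    norm_num
  · have := scale_pos m
    positivity

end Ehrenfest

end

theorem mainTheorem3 :
    -- `H = -i d/dx` is self-adjoint, and `exp (-i t H)` is translation by `t`
    IsSelfAdjoint Ehrenfest.momentum ∧
    (∀ U : ℝ → Ehrenfest.L2R →L[ℂ] Ehrenfest.L2R,
      Ehrenfest.IsUnitaryGroupOf Ehrenfest.momentum U ↔ U = Ehrenfest.translation) ∧
    -- the operator `A`
    ∃ A : Ehrenfest.L2R →ₗ.[ℂ] Ehrenfest.L2R,
      Ehrenfest.WeakHypotheses Ehrenfest.momentum A Ehrenfest.translation ∧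
      ¬ IsSelfAdjoint A ∧ ¬ A.IsClosed ∧
      Ehrenfest.tent ∈ A.domain ⊓ Ehrenfest.momentum.domain ∧
      ∃ h : ∀ t, Ehrenfest.translation t Ehrenfest.tent ∈
          A.domain ⊓ Ehrenfest.momentum.domain,
        -- `⟨A⟩_{ψ(t)}` is real and unbounded on `(0, 1)`
        (∀ t, (Ehrenfest.expVal A ⟨Ehrenfest.translation t Ehrenfest.tent, (h t).1⟩).im = 0) ∧
        (∀ C : ℝ, ∃ t ∈ Set.Ioo (0 : ℝ) 1,
          C < (Ehrenfest.expVal A ⟨Ehrenfest.translation t Ehrenfest.tent, (h t).1⟩).re) ∧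
        -- it is not even continuous, and the conclusions fail that hold for self-adjoint,
        -- respectively closed hermitean, `A`
        (¬ Continuous fun t =>
          Ehrenfest.expVal A ⟨Ehrenfest.translation t Ehrenfest.tent, (h t).1⟩) ∧
        ¬ Ehrenfest.EhrenfestConclusion Ehrenfest.momentum A Ehrenfest.translation
          Ehrenfest.tent h ∧
        ¬ Ehrenfest.LocallyBoundedAlongOrbit A Ehrenfest.translation
          Ehrenfest.tent (fun t => (h t).1) := by
  have hw := Ehrenfest.weakHypotheses_haarOperator
  have h0 : Ehrenfest.tent ∈ Ehrenfest.haarOperator.domain ⊓ Ehrenfest.momentum.domain :=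
    ⟨Ehrenfest.tent_mem_finiteDomain, Ehrenfest.tent_mem_momentum_domain⟩
  have h := fun t => hw.invariant t _ h0
  have hub := Ehrenfest.exists_lt_expVal_haarOperator fun t => (h t).1
  have hnc : ¬ Continuous fun t => Ehrenfest.expVal Ehrenfest.haarOperator
      ⟨Ehrenfest.translation t Ehrenfest.tent, (h t).1⟩ := by
    intro hcont
    obtain ⟨C, hC⟩ := (isCompact_Icc (a := (0 : ℝ)) (b := 1)).bddAbove_image
      (Complex.continuous_re.comp hcont).continuousOn
    obtain ⟨t, ht, hlt⟩ := hub C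
    exact hlt.not_ge (hC ⟨t, Set.Ioo_subset_Icc_self ht, rfl⟩)
  refine ⟨Ehrenfest.isSelfAdjoint_momentum, Ehrenfest.isUnitaryGroupOf_momentum_iff,
    Ehrenfest.haarOperator, hw,
    fun hsa => Ehrenfest.haarOperator_not_isClosed hsa.isClosed,
    Ehrenfest.haarOperator_not_isClosed, h0, h,
    fun t => Ehrenfest.expVal_rankOneSum_im _, hub, hnc, fun hE => hnc hE.1.continuous, ?_⟩
  intro hb
  obtain ⟨C, hC⟩ := hb (Set.Ioo 0 1) (Metric.isBounded_Ioo 0 1)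
  -- Translation preserves the norm, so by Cauchy–Schwarz a bound `C` on `‖A ψ(t)‖` would bound the
  -- expectation by `‖tent‖ * C`.
  obtain ⟨t, ht, hlt⟩ := hub (‖Ehrenfest.tent‖ * C)
  refine hlt.not_ge ((Complex.re_le_norm _).trans ?_)
  refine (norm_inner_le_norm _ _).trans ?_
  have hn : ‖Ehrenfest.translation t Ehrenfest.tent‖ = ‖Ehrenfest.tent‖ :=
    Lp.norm_compMeasurePreserving _ _
  rw [hn]
  exact mul_le_mul_of_nonneg_left (hC ⟨t, ht, rfl⟩) (norm_nonneg _)
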